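/- **Theorem 3.** A *planar 4-valent graph* is a nonempty compact subset of the plane which near each of its points is either an arc or a 4-valent vertex (two arcs crossing in one point); closed curves without vertices and disconnected graphs are allowed, and graphs are considered up to planar isotopy. The *unknot* is a single circle without vertices. Let $K$ be a field and let $A,B,a\in K$ with $A\neq B$ and $a\neq 0$ (for instance the field of rational functions in three variables $A,B,a$). Put $$\mu=\frac{a-a^{-1}}{A-B}+1,\qquad \mathcal O=\frac{Aa^{-1}-Ba}{A-B}-(A+B),\qquad \gamma=\frac{B^2a-A^2a^{-1}}{A-B}+AB,\qquad \xi=\frac{B^3a-A^3a^{-1}}{A-B}.$$ Then there is at most one function $[\,\cdot\,]$ from planar 4-valent graphs to $K$ which takes the value $1$ on the unknot and satisfies the following four identities (the graphical calculus), each for all families of graphs that agree outside a disc and inside it are the indicated pictures. 1. $[C]=\mu\,[I]$, where $I$ is a single arc and $C$ is this arc together with a small circle beside it. 2. $[L]=\mathcal O\,[I]$, where $L$ is an arc that crosses itself in one vertex and so forms an empty loop. 3. $[D]=(1-AB)[E]+\gamma[E']-(A+B)[X]$, where $D$ consists of two vertices joined by two edges bounding an empty bigon, one vertex carrying the ends $1,2$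 and the other the ends $3,4$ (ends numbered in cyclic order); $E$ consists of two disjoint arcs $23$, $41$; $E'$ of two disjoint arcs $12$, $34$; and $X$ is a single vertex. 4. With six ends numbered $1,\dots,6$ in cyclic order, $$[T']-[T]=AB\bigl([V_{23}]-[V_{12}]+[V_{45}]-[V_{34}]+[V_{61}]-[V_{56}]\bigr)+\xi\bigl([J]-[J']\bigr).$$ Here $T$ and $T'$ consist of three arcs $14,25,36$ crossing pairwise in three vertices around an empty triangle; in $T$ the three vertices carry the pairs of ends $\{1,2\},\{3,4\},\{5,6\}$, in $T'$ the pairs $\{2,3\},\{4,5\},\{6,1\}$. In $V_{ij}$ an arc joins the neighbouring ends $i,j$ and the other four ends meet in one vertex. $J$ consists of three disjoint arcs $12,34,56$ and $J'$ of three disjoint arcs $23,45,61$. -/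

import Mathlib

/-!
# Planar 4-valent graphs and the graphical calculus

A planar 4-valent graph is a compact subset of the plane which near each of its points is either an
arc or a (rigid) 4-valent vertex, i.e. two arcs crossing in one point; closed curves without
vertices are allowed, and the graph may be disconnected, with its components nested in any way.

Put in general position with respect to the height function, such a graph is a finite sequence of
events at distinct heights: a local minimum, a local maximum, or a vertex with two edges leaving
downwards and two edges leaving upwards; between two events there are only vertical strands.
Reading from bottom to top and recording how many strands pass to the left of each event
gives a finite word, which determines the plane graph up to planar isotopy.
Two words give isotopic plane graphs if and only if they are connected by
exchanges of the heights of two consecutive events that lie side by side, by straightening of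
zigzags, and by quarter turns of vertices.  No other move is built in: in particular the relative
position of the components, and the choice of the unbounded region, are part of the data.
-/

namespace PlanarCalculus

/-- The local events of a plane graph in general position with respect to height. -/
inductive EventKind where
  /-- a local minimum: two new strands start -/
  | cup
  /-- a local maximum: two neighbouring strands are joined and end -/
  | cap
  /-- a 4-valent vertex: two neighbouring strands come in from below, two leave upwards -/
  | vertex
  deriving DecidableEq

/-- Number of strands which enter the event from below. -/
def EventKind.below : EventKind → ℕ
  | .cup => 0
  | .cap => 2
  | .vertex => 2

/-- Number of strands which leave the event upwards. -/
def EventKind.above : EventKind → ℕ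
  | .cup => 2
  | .cap => 0
  | .vertex => 2

/-- A local event together with the number `pos` of strands that pass on its left. -/
structure Event where
  kind : EventKind
  pos : ℕ
  deriving DecidableEq

/-- A local minimum with `i` strands on its left. -/
def cup (i : ℕ) : Event := ⟨.cup, i⟩

/-- A local maximum with `i` strands on its left. -/
def cap (i : ℕ) : Event := ⟨.cap, i⟩

/-- A 4-valent vertex with `i` strands on its left. -/
def vertex (i : ℕ) : Event := ⟨.vertex, i⟩

/-- The number of strands after a word of events (read from bottom to top) has been applied to `n`
strands; `none` if some event does not find the strands that it needs. -/
def strandsAfter : ℕ → List Event → Option ℕ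
  | n, [] => some n
  | n, e :: w =>
    if e.pos + e.kind.below ≤ n then strandsAfter (n - e.kind.below + e.kind.above) w else none

/-- `IsTangle m w n`: the word `w` is a picture in a horizontal strip with `m` ends on the bottom
line and `n` ends on the top line. -/
def IsTangle (m : ℕ) (w : List Event) (n : ℕ) : Prop := strandsAfter m w = some n

instance (m : ℕ) (w : List Event) (n : ℕ) : Decidable (IsTangle m w n) :=
  inferInstanceAs (Decidable (strandsAfter m w = some n))

/-- A diagram of a nonempty planar 4-valent graph: a nonempty word of events without loose ends. -/
structure Diagram where
  events : List Event
  closed : IsTangle 0 events 0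
  nonempty : events ≠ []

/-- The elementary planar isotopies, as local changes of words. -/
inductive Move : List Event → List Event → Prop
  /-- Two consecutive events that lie side by side exchange their heights; `i` strands pass to the
  left of both and `d` strands pass between the two. -/
  | exchange (k l : EventKind) (i d : ℕ) :
      Move [⟨k, i⟩, ⟨l, i + k.above + d⟩] [⟨l, i + k.below + d⟩, ⟨k, i⟩]
  /-- A zigzag is straightened to a vertical strand. -/
  | zigzagLeft (i : ℕ) : Move [cup i, cap (i + 1)] []
  /-- The mirror image zigzag is straightened to a vertical strand. -/
  | zigzagRight (i : ℕ) : Move [cup (i + 1), cap i] []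
  /-- A vertex is rotated by a quarter turn: its upper left edge bends down to the lower left end
  of the picture, and its lower right edge bends up to the upper right end. -/
  | turnLeft (i : ℕ) : Move [cup (i + 2), vertex (i + 1), cap i] [vertex i]
  /-- A vertex is rotated by a quarter turn the other way. -/
  | turnRight (i : ℕ) : Move [cup i, vertex (i + 1), cap (i + 2)] [vertex i]

/-- Two diagrams are related by one elementary planar isotopy, performed somewhere in them. -/
def ElementaryIsotopy (D E : Diagram) : Prop :=
  ∃ u s t v : List Event, Move s t ∧ D.events = u ++ s ++ v ∧ E.events = u ++ t ++ v

/-- Nonempty planar 4-valent graphs up to planar isotopy: diagrams modulo the equivalence relation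
generated by the elementary planar isotopies. -/
def PlanarGraph : Type := Quot ElementaryIsotopy

/-- The planar graph given by a diagram. -/
def PlanarGraph.mk (D : Diagram) : PlanarGraph := Quot.mk ElementaryIsotopy D

/-- The unknot: a single circle without vertices. -/
def unknot : PlanarGraph := .mk ⟨[cup 0, cap 0], by decide, by decide⟩

/-- An event moved to the right by `j` strands. -/
def Event.shift (j : ℕ) (e : Event) : Event := ⟨e.kind, j + e.pos⟩

/-- A picture in a disc (a rectangle) with `p` ends on its bottom and `p` ends on its top. -/
structure LocalPicture (p : ℕ) where
  events : List Event
  isTangle : IsTangle p events p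

/-- The part of a plane graph outside a disc (a rectangle) which meets the graph in `p` points of
its bottom side and `p` points of its top side: what lies below, what lies above, and the numbers of
strands that pass to the left and to the right. -/
structure Surroundings (p : ℕ) where
  left : ℕ
  right : ℕ
  lower : List Event
  upper : List Event
  lower_isTangle : IsTangle 0 lower (left + p + right)
  upper_isTangle : IsTangle (left + p + right) upper 0

theorem IsTangle.append {m n r : ℕ} {u w : List Event} (hu : IsTangle m u n)
    (hw : IsTangle n w r) : IsTangle m (u ++ w) r := by
  induction u generalizing m with
  | nil =>
    simp only [IsTangle, strandsAfter, Option.some.injEq] at hu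
    subst hu
    exact hw
  | cons e u ih =>
    simp only [IsTangle, strandsAfter, List.cons_append] at hu ⊢
    split_ifs at hu ⊢ with h
    exact ih hu

theorem IsTangle.shift {m n : ℕ} {w : List Event} (hw : IsTangle m w n) (j r : ℕ) :
    IsTangle (j + m + r) (w.map (Event.shift j)) (j + n + r) := by
  induction w generalizing m with
  | nil =>
    simp only [IsTangle, strandsAfter, Option.some.injEq] at hw
    subst hw
    rfl
  | cons e w ih =>
    simp only [IsTangle, strandsAfter] at hw
    split_ifs at hw with h
    have h' : (e.shift j).pos + (e.shift j).kind.below ≤ j + m + r := by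
      simp only [Event.shift]
      omega
    have h2 : j + m + r - (e.shift j).kind.below + (e.shift j).kind.above =
        j + (m - e.kind.below + e.kind.above) + r := by
      simp only [Event.shift]
      omega
    simp only [IsTangle, strandsAfter, List.map_cons, if_pos h', h2]
    exact ih hw

/-- The planar graph obtained by inserting a local picture into its surroundings. -/
def Surroundings.fill {p : ℕ} [NeZero p] (S : Surroundings p) (T : LocalPicture p) : PlanarGraph :=
  .mk
    { events := S.lower ++ T.events.map (Event.shift S.left) ++ S.upper
      closed := (S.lower_isTangle.append (T.isTangle.shift S.left S.right)).append S.upper_isTangle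
      nonempty := by
        intro h
        have h1 : S.lower = [] := by simp_all
        have h2 := S.lower_isTangle
        rw [h1] at h2
        simp only [IsTangle, strandsAfter, Option.some.injEq] at h2
        have h3 := NeZero.ne p
        omega }

/-! ### The local pictures -/

/-- A strand. -/
def strand : LocalPicture 1 := ⟨[], by decide⟩

/-- A strand with a small circle beside it. -/
def strandWithCircle : LocalPicture 1 := ⟨[cup 0, cap 0], by decide⟩

/-- A strand which crosses itself in one vertex, forming an empty loop. -/
def strandWithLoop : LocalPicture 1 := ⟨[cup 1, vertex 0, cap 1], by decide⟩

/-- Two vertices joined by two edges which bound an empty bigon. -/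
def bigon : LocalPicture 2 := ⟨[vertex 0, vertex 0], by decide⟩

/-- A single vertex. -/
def crossing : LocalPicture 2 := ⟨[vertex 0], by decide⟩

/-- Two arcs, each of which joins an end at one vertex of the bigon to the neighbouring end at the
other vertex. -/
def alongBigon : LocalPicture 2 := ⟨[], by decide⟩

/-- Two arcs, each of which joins the two ends at the same vertex of the bigon. -/
def acrossBigon : LocalPicture 2 := ⟨[cap 0, cup 0], by decide⟩

/-! In the pictures with six ends we number the ends counterclockwise: `1, 2, 3` at the bottom from
left to right, `4, 5, 6` at the top from right to left. -/

/-- Three arcs `14`, `25`, `36` crossing each other in three vertices around an empty triangle;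
the vertices carry the ends `1, 2`, the ends `3, 4` and the ends `5, 6`. -/
def triangle12 : LocalPicture 3 := ⟨[vertex 0, vertex 1, vertex 0], by decide⟩

/-- Three arcs `14`, `25`, `36` crossing each other in three vertices around an empty triangle;
the vertices carry the ends `2, 3`, the ends `4, 5` and the ends `6, 1`. -/
def triangle23 : LocalPicture 3 := ⟨[vertex 1, vertex 0, vertex 1], by decide⟩

/-- An arc joins the ends `1, 2`; the other four ends meet in a vertex. -/
def arc12 : LocalPicture 3 := ⟨[cap 0, cup 0, vertex 1], by decide⟩

/-- An arc joins the ends `2, 3`; the other four ends meet in a vertex. -/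
def arc23 : LocalPicture 3 := ⟨[cap 1, cup 1, vertex 0], by decide⟩

/-- An arc joins the ends `3, 4`; the other four ends meet in a vertex. -/
def arc34 : LocalPicture 3 := ⟨[vertex 0], by decide⟩

/-- An arc joins the ends `4, 5`; the other four ends meet in a vertex. -/
def arc45 : LocalPicture 3 := ⟨[vertex 0, cap 1, cup 1], by decide⟩

/-- An arc joins the ends `5, 6`; the other four ends meet in a vertex. -/
def arc56 : LocalPicture 3 := ⟨[vertex 1, cap 0, cup 0], by decide⟩

/-- An arc joins the ends `6, 1`; the other four ends meet in a vertex. -/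
def arc61 : LocalPicture 3 := ⟨[vertex 1], by decide⟩

/-- Three disjoint arcs `12`, `34`, `56`. -/
def arcs12 : LocalPicture 3 := ⟨[cap 0, cup 0], by decide⟩

/-- Three disjoint arcs `23`, `45`, `61`. -/
def arcs23 : LocalPicture 3 := ⟨[cap 1, cup 1], by decide⟩

/-! ### The coefficients and the identities -/

section Coefficients

variable {K : Type*} [Field K]

/-- The coefficient `μ`. -/
def mu (A B a : K) : K := (a - a⁻¹) / (A - B) + 1

/-- The coefficient `𝒪`. -/
def loopCoeff (A B a : K) : K := (A * a⁻¹ - B * a) / (A - B) - (A + B)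

/-- The coefficient `γ`. -/
def gammaCoeff (A B a : K) : K := (B ^ 2 * a - A ^ 2 * a⁻¹) / (A - B) + A * B

/-- The coefficient `ξ`. -/
def xi (A B a : K) : K := (B ^ 3 * a - A ^ 3 * a⁻¹) / (A - B)

/-- The four identities of the graphical calculus, for a function `P` on planar 4-valent graphs:
each holds for all graphs which differ only in the marked local picture. -/
structure GraphicalCalculus (A B a : K) (P : PlanarGraph → K) : Prop where
  circle : ∀ S : Surroundings 1,
    P (S.fill strandWithCircle) = mu A B a * P (S.fill strand)
  loop : ∀ S : Surroundings 1,
    P (S.fill strandWithLoop) = loopCoeff A B a * P (S.fill strand)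
  bigon : ∀ S : Surroundings 2,
    P (S.fill bigon) = (1 - A * B) * P (S.fill alongBigon)
      + gammaCoeff A B a * P (S.fill acrossBigon) - (A + B) * P (S.fill crossing)
  triangle : ∀ S : Surroundings 3,
    P (S.fill triangle23) - P (S.fill triangle12) =
      A * B * (P (S.fill arc23) - P (S.fill arc12) + P (S.fill arc45) - P (S.fill arc34)
        + P (S.fill arc61) - P (S.fill arc56))
      + xi A B a * (P (S.fill arcs12) - P (S.fill arcs23))

end Coefficients

end PlanarCalculus

namespace PlanarCalculus

/-! The identities are linear, so the difference `R` of two solutions satisfies them as well and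
vanishes on the unknot; it suffices that such an `R` is zero. This holds because the calculus
reduces every diagram to a combination of the empty word and one circle.

Cut a closed diagram by a horizontal line. Through `R`, the lower part becomes a functional on upper
words, and adding further events to it becomes the linear operator `act`. Isotopies and the four
identities turn into equations between such operators on `lowerSpace`, so that combinations of
tangles can be manipulated as vectors.

The diagram is then built event by event, keeping its functional in `normalSpace`: the last strand
ends the topmost minimum, and above that minimum there are only vertices and hooks (a maximum
followed by a minimum) on the other strands. Zigzags reduce any minimum or maximum to one in the
last position, up to hooks. What remains is stability under vertices, hooks and the last maximum.

The core is a reduction as in Hecke and Birman-Murakami-Wenzl algebras (`act_mem_sandwich`): modulo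
the calculus, the generators in the last position are needed at most once in a word. Two occurrences
separated by at most one generator in the previous position form a triangle, a bigon, a loop, a
circle or a zigzag, or can be slid into one of the previous strands. Everything else commutes out of
the way. -/

/-! ### Words of events as tangles -/

theorem strandsAfter_append (m : ℕ) (u w : List Event) :
    strandsAfter m (u ++ w) = (strandsAfter m u).bind fun n => strandsAfter n w := by
  induction u generalizing m with
  | nil => rfl
  | cons e u ih =>
    simp only [List.cons_append, strandsAfter]
    split_ifs
    · exact ih _
    · rfl

theorem isTangle_append_iff {m n r : ℕ} {u w : List Event} (hu : IsTangle m u n) :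
    IsTangle m (u ++ w) r ↔ IsTangle n w r := by
  unfold IsTangle at *
  rw [strandsAfter_append, hu]
  rfl

theorem isTangle_nil (n : ℕ) : IsTangle n [] n := rfl

theorem isTangle_cons {n r : ℕ} {e : Event} {w : List Event} (h : e.pos + e.kind.below ≤ n)
    (hw : IsTangle (n - e.kind.below + e.kind.above) w r) : IsTangle n (e :: w) r := by
  simpa only [IsTangle, strandsAfter, if_pos h] using hw

theorem isTangle_cons_iff {n r : ℕ} {e : Event} {w : List Event} :
    IsTangle n (e :: w) r ↔
      e.pos + e.kind.below ≤ n ∧ IsTangle (n - e.kind.below + e.kind.above) w r := by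
  simp only [IsTangle, strandsAfter]
  split_ifs with h <;> simp [h]

theorem isTangle_cup_cons {n r i : ℕ} {w : List Event} :
    IsTangle n (cup i :: w) r ↔ i ≤ n ∧ IsTangle (n + 2) w r := by
  simp [isTangle_cons_iff, cup, EventKind.below, EventKind.above]

theorem isTangle_cap_cons {n r i : ℕ} {w : List Event} :
    IsTangle n (cap i :: w) r ↔ i + 2 ≤ n ∧ IsTangle (n - 2) w r := by
  simp [isTangle_cons_iff, cap, EventKind.below, EventKind.above]

theorem isTangle_vertex_cons {n r i : ℕ} {w : List Event} :
    IsTangle n (vertex i :: w) r ↔ i + 2 ≤ n ∧ IsTangle n w r := by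
  simp only [isTangle_cons_iff, vertex, EventKind.below, EventKind.above]
  constructor
  · rintro ⟨h, h'⟩
    rw [Nat.sub_add_cancel (by omega)] at h'
    exact ⟨h, h'⟩
  · rintro ⟨h, h'⟩
    rw [Nat.sub_add_cancel (by omega)]
    exact ⟨h, h'⟩

theorem isTangle_nil_iff {n r : ℕ} : IsTangle n [] r ↔ n = r := by
  simp [IsTangle, strandsAfter]

/-! ### Functionals defined by lower words -/

variable {K : Type*} [Field K]

open Classical in
/-- The value of a function on planar graphs at a word, extended by zero to all words. -/
noncomputable def wordValue (R : PlanarGraph → K) (w : List Event) : K :=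
  if h : IsTangle 0 w 0 ∧ w ≠ [] then R (.mk ⟨w, h.1, h.2⟩) else 0

/-- Precomposition of a functional on words with the insertion of `w` at the bottom. -/
def act (w : List Event) : (List Event → K) →ₗ[K] (List Event → K) :=
  LinearMap.funLeft K K (w ++ ·)

theorem act_apply (w : List Event) (φ : List Event → K) (u : List Event) :
    act w φ u = φ (w ++ u) := rfl

theorem act_append (w z : List Event) (φ : List Event → K) :
    act (w ++ z) φ = act z (act w φ) := by
  funext u
  simp [act_apply]

theorem act_cons (e : Event) (w : List Event) (φ : List Event → K) :
    act (e :: w) φ = act w (act [e] φ) := rfl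

/-- The functional on upper words that a lower word defines. -/
noncomputable def lowerFunctional (R : PlanarGraph → K) (w : List Event) : List Event → K :=
  fun u => wordValue R (w ++ u)

theorem act_lowerFunctional (R : PlanarGraph → K) (w z : List Event) :
    act z (lowerFunctional R w) = lowerFunctional R (w ++ z) := by
  funext u
  simp [act_apply, lowerFunctional]

/-- The space spanned by all lower words with `n` upper ends. -/
noncomputable def lowerSpace (R : PlanarGraph → K) (n : ℕ) : Submodule K (List Event → K) :=
  Submodule.span K {φ | ∃ w, IsTangle 0 w n ∧ φ = lowerFunctional R w}

variable {R : PlanarGraph → K}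

theorem act_mem_lowerSpace {m n : ℕ} {w : List Event} (hw : IsTangle m w n)
    {φ : List Event → K} (hφ : φ ∈ lowerSpace R m) : act w φ ∈ lowerSpace R n := by
  induction hφ using Submodule.span_induction with
  | mem x hx =>
    obtain ⟨z, hz, rfl⟩ := hx
    rw [act_lowerFunctional]
    exact Submodule.subset_span ⟨_, hz.append hw, rfl⟩
  | zero => simp
  | add x y _ _ hx hy => rw [map_add]; exact add_mem hx hy
  | smul c x _ hx => rw [map_smul]; exact Submodule.smul_mem _ c hx

theorem eqOn_lowerSpace {n : ℕ} {f g : (List Event → K) →ₗ[K] (List Event → K)}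
    (h : ∀ w u, IsTangle 0 w n → f (lowerFunctional R w) u = g (lowerFunctional R w) u)
    {φ : List Event → K} (hφ : φ ∈ lowerSpace R n) : f φ = g φ := by
  refine LinearMap.eqOn_span (f := f) (g := g) ?_ hφ
  rintro _ ⟨w, hw, rfl⟩
  funext u
  exact h w u hw

theorem wordValue_eq_zero {w : List Event} (h : ¬ IsTangle 0 w 0) : wordValue R w = 0 :=
  dif_neg fun h' => h h'.1

/-- Both sides of the move have the same numbers of ends, so the two words are closed or not closed
together; in the second case both values are the default zero. -/
theorem wordValue_eq_of_move {n m : ℕ} {w s t u : List Event} (hst : Move s t)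
    (hw : IsTangle 0 w n) (hs : IsTangle n s m) (ht : IsTangle n t m) :
    wordValue R (w ++ s ++ u) = wordValue R (w ++ t ++ u) := by
  have h1 := isTangle_append_iff (hw.append hs) (w := u) (r := 0)
  have h2 := isTangle_append_iff (hw.append ht) (w := u) (r := 0)
  by_cases hu : IsTangle m u 0
  -- Only a zigzag has an empty right side, and a zigzag needs a strand, so it cannot be the whole
  -- diagram.
  · by_cases hn : w ++ t ++ u = []
    · exfalso
      simp only [List.append_eq_nil_iff] at hn
      obtain ⟨⟨rfl, rfl⟩, rfl⟩ := hn
      simp only [isTangle_nil_iff] at hw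
      subst hw
      cases hst <;> simp [isTangle_cup_cons, isTangle_cap_cons] at hs
    · have hn' : w ++ s ++ u ≠ [] := by
        have : s ≠ [] := by cases hst <;> simp
        simp [this]
      rw [wordValue, wordValue, dif_pos ⟨h1.2 hu, hn'⟩, dif_pos ⟨h2.2 hu, hn⟩]
      exact congrArg R (Quot.sound ⟨w, s, t, u, hst, rfl, rfl⟩)
  · rw [wordValue_eq_zero (fun h => hu (h1.1 h)), wordValue_eq_zero (fun h => hu (h2.1 h))]

/-! ### Planar isotopies as equalities of operators -/

/-- Two words act in the same way on all functionals given by lower words with `n` ends. -/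
def WordEq (R : PlanarGraph → K) (n : ℕ) (s t : List Event) : Prop :=
  ∀ φ ∈ lowerSpace R n, act s φ = act t φ

theorem WordEq.symm {n : ℕ} {s t : List Event} (h : WordEq R n s t) : WordEq R n t s :=
  fun φ hφ => (h φ hφ).symm

theorem WordEq.refl (n : ℕ) (s : List Event) : WordEq R n s s := fun _ _ => rfl

theorem WordEq.trans {n : ℕ} {s t r : List Event} (h : WordEq R n s t) (h' : WordEq R n t r) :
    WordEq R n s r :=
  fun φ hφ => (h φ hφ).trans (h' φ hφ)

theorem WordEq.context {m n : ℕ} {s t : List Event} (h : WordEq R n s t) (p q : List Event)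
    (hp : IsTangle m p n) : WordEq R m (p ++ s ++ q) (p ++ t ++ q) := by
  intro φ hφ
  simp only [act_append]
  rw [h _ (act_mem_lowerSpace hp hφ)]

theorem WordEq.of_move {n m : ℕ} {s t : List Event} (hst : Move s t) (hs : IsTangle n s m)
    (ht : IsTangle n t m) : WordEq R n s t := by
  intro φ hφ
  refine eqOn_lowerSpace (fun w u hw => ?_) hφ
  rw [act_lowerFunctional, act_lowerFunctional]
  exact wordValue_eq_of_move hst hw hs ht

theorem wordEq_exchange (k l : EventKind) {n i d : ℕ} (h : i + k.below + d + l.below ≤ n) :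
    WordEq R n [⟨k, i⟩, ⟨l, i + k.above + d⟩] [⟨l, i + k.below + d⟩, ⟨k, i⟩] := by
  refine WordEq.of_move (.exchange k l i d)
    (m := n - k.below - l.below + k.above + l.above) ?_ ?_ <;>
  · simp only [isTangle_cons_iff, isTangle_nil_iff]
    omega

/-- The event descends past `w` one exchange at a time. Its position changes from `b + d` to `a + d`
because `w`, on its left, turns `a` strands into `b`. -/
theorem wordEq_event_right (l : EventKind) {a b n d : ℕ} {w : List Event} (hw : IsTangle a w b)
    (h : a + d + l.below ≤ n) :
    WordEq R n (w ++ [⟨l, b + d⟩]) (⟨l, a + d⟩ :: w) := by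
  induction w generalizing a n with
  | nil =>
    rw [isTangle_nil_iff] at hw
    subst hw
    exact .refl _ _
  | cons e w ih =>
    rw [isTangle_cons_iff] at hw
    obtain ⟨he, hw⟩ := hw
    have h1 := ih (n := n - e.kind.below + e.kind.above) hw (by omega)
    have h2 := wordEq_exchange (R := R) e.kind l (n := n) (i := e.pos)
      (d := a + d - e.pos - e.kind.below) (by omega)
    rw [show e.pos + e.kind.above + (a + d - e.pos - e.kind.below) =
      a - e.kind.below + e.kind.above + d by omega,
      show e.pos + e.kind.below + (a + d - e.pos - e.kind.below) = a + d by omega] at h2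
    have h3 := h1.context [e] [] (m := n) (isTangle_cons (by omega) (isTangle_nil _))
    have h4 := h2.context [] w (isTangle_nil _)
    simp only [List.append_nil, List.nil_append, List.cons_append] at h3 h4
    exact h3.trans h4

theorem wordEq_word_right {a n : ℕ} {w z : List Event} (hw : IsTangle a w a) {r : ℕ}
    (hz : IsTangle n z r) (hpos : ∀ e ∈ z, a ≤ e.pos) (han : a ≤ n) :
    WordEq R n (w ++ z) (z ++ w) := by
  induction z generalizing n with
  | nil => simpa using WordEq.refl n w
  | cons e z ih =>
    rw [isTangle_cons_iff] at hz
    have hp := hpos e (by simp)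
    have h1 := wordEq_event_right (R := R) e.kind (n := n) (d := e.pos - a) hw (by omega)
    rw [show a + (e.pos - a) = e.pos by omega] at h1
    have h2 := h1.context [] z (isTangle_nil _)
    have h3 := (ih hz.2 (fun e he => hpos e (by simp [he])) (by omega)).context [e] []
      (isTangle_cons hz.1 (isTangle_nil _))
    simp only [List.append_nil, List.nil_append, List.cons_append, List.append_assoc] at h2 h3 ⊢
    exact h2.trans h3

theorem wordEq_cup_cup {n i d : ℕ} (h : i + d ≤ n) :
    WordEq R n [cup i, cup (i + 2 + d)] [cup (i + d), cup i] :=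
  wordEq_exchange .cup .cup h

theorem wordEq_cap_cap {n i d : ℕ} (h : i + d + 4 ≤ n) :
    WordEq R n [cap i, cap (i + d)] [cap (i + 2 + d), cap i] :=
  wordEq_exchange .cap .cap (by simp only [EventKind.below]; omega)

theorem wordEq_cup_cap {n i d : ℕ} (h : i + d + 2 ≤ n) :
    WordEq R n [cup i, cap (i + 2 + d)] [cap (i + d), cup i] :=
  wordEq_exchange .cup .cap (by simp only [EventKind.below]; omega)

theorem wordEq_cap_cup {n i d : ℕ} (h : i + d + 2 ≤ n) :
    WordEq R n [cap i, cup (i + d)] [cup (i + 2 + d), cap i] :=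
  wordEq_exchange .cap .cup (by simp only [EventKind.below]; omega)

theorem wordEq_vertex_cup {n i d : ℕ} (h : i + d + 2 ≤ n) :
    WordEq R n [vertex i, cup (i + 2 + d)] [cup (i + 2 + d), vertex i] :=
  wordEq_exchange .vertex .cup (by simp only [EventKind.below]; omega)

theorem wordEq_vertex_cap {n i d : ℕ} (h : i + d + 4 ≤ n) :
    WordEq R n [vertex i, cap (i + 2 + d)] [cap (i + 2 + d), vertex i] :=
  wordEq_exchange .vertex .cap (by simp only [EventKind.below]; omega)

theorem wordEq_zigzag_left {n i : ℕ} (h : i + 1 ≤ n) : WordEq R n [cup i, cap (i + 1)] [] :=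
  .of_move (.zigzagLeft i) (m := n)
    (by simp only [isTangle_cup_cons, isTangle_cap_cons, isTangle_nil_iff]; omega) rfl

theorem wordEq_zigzag_right {n i : ℕ} (h : i + 1 ≤ n) : WordEq R n [cup (i + 1), cap i] [] :=
  .of_move (.zigzagRight i) (m := n)
    (by simp only [isTangle_cup_cons, isTangle_cap_cons, isTangle_nil_iff]; omega) rfl

theorem wordEq_turn_left {n i : ℕ} (h : i + 2 ≤ n) :
    WordEq R n [cup (i + 2), vertex (i + 1), cap i] [vertex i] :=
  .of_move (.turnLeft i) (m := n)
    (by simp only [isTangle_cup_cons, isTangle_cap_cons, isTangle_vertex_cons,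
        isTangle_nil_iff]; omega)
    (by simp only [isTangle_vertex_cons, isTangle_nil_iff, and_true]; omega)

theorem wordEq_turn_right {n i : ℕ} (h : i + 2 ≤ n) :
    WordEq R n [cup i, vertex (i + 1), cap (i + 2)] [vertex i] :=
  .of_move (.turnRight i) (m := n)
    (by simp only [isTangle_cup_cons, isTangle_cap_cons, isTangle_vertex_cons,
        isTangle_nil_iff]; omega)
    (by simp only [isTangle_vertex_cons, isTangle_nil_iff, and_true]; omega)

/-- A vertex at the foot of a local minimum slides from one side to the other. -/
theorem wordEq_cup_vertex {n i : ℕ} (h : i + 1 ≤ n) :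
    WordEq R n [cup (i + 1), vertex i] [cup i, vertex (i + 1)] := by
  have h1 : WordEq R n [cup (i + 1), vertex i]
      [cup (i + 1), cup i, vertex (i + 1), cap (i + 2)] :=
    ((wordEq_turn_right (n := n + 2) (by omega)).context [cup (i + 1)] []
      (by simp only [isTangle_cup_cons, isTangle_nil_iff, and_true]; omega)).symm
  have h2 : WordEq R n [cup (i + 1), cup i, vertex (i + 1), cap (i + 2)]
      [cup i, cup (i + 3), vertex (i + 1), cap (i + 2)] :=
    ((wordEq_cup_cup (d := 1) (by omega)).context [] [vertex (i + 1), cap (i + 2)]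
      (isTangle_nil n)).symm
  have h3 : WordEq R n [cup i, cup (i + 3), vertex (i + 1), cap (i + 2)]
      [cup i, vertex (i + 1), cup (i + 3), cap (i + 2)] :=
    ((wordEq_vertex_cup (n := n + 2) (i := i + 1) (d := 0) (by omega)).context [cup i]
      [cap (i + 2)] (by simp only [isTangle_cup_cons, isTangle_nil_iff, and_true]; omega)).symm
  have h4 : WordEq R n [cup i, vertex (i + 1), cup (i + 3), cap (i + 2)]
      [cup i, vertex (i + 1)] :=
    (wordEq_zigzag_right (n := n + 2) (i := i + 2) (by omega)).context [cup i, vertex (i + 1)] []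
      (by simp only [isTangle_cup_cons, isTangle_vertex_cons, isTangle_nil_iff, and_true]; omega)
  exact ((h1.trans h2).trans h3).trans h4

/-- A vertex at the top of a local maximum slides from one side to the other. -/
theorem wordEq_vertex_cap_slide {n i : ℕ} (h : i + 3 ≤ n) :
    WordEq R n [vertex i, cap (i + 1)] [vertex (i + 1), cap i] := by
  have h1 : WordEq R n [vertex i, cap (i + 1)]
      [cup (i + 2), vertex (i + 1), cap i, cap (i + 1)] :=
    ((wordEq_turn_left (by omega)).context [] [cap (i + 1)] (isTangle_nil n)).symm
  have h2 : WordEq R n [cup (i + 2), vertex (i + 1), cap i, cap (i + 1)]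
      [cup (i + 2), vertex (i + 1), cap (i + 3), cap i] :=
    (wordEq_cap_cap (n := n + 2) (d := 1) (by omega)).context [cup (i + 2), vertex (i + 1)] []
      (by simp only [isTangle_cup_cons, isTangle_vertex_cons, isTangle_nil_iff, and_true]; omega)
  have h3 : WordEq R n [cup (i + 2), vertex (i + 1), cap (i + 3), cap i]
      [cup (i + 2), cap (i + 3), vertex (i + 1), cap i] :=
    (wordEq_vertex_cap (n := n + 2) (i := i + 1) (d := 0) (by omega)).context [cup (i + 2)]
      [cap i] (by simp only [isTangle_cup_cons, isTangle_nil_iff, and_true]; omega)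
  have h4 : WordEq R n [cup (i + 2), cap (i + 3), vertex (i + 1), cap i]
      [vertex (i + 1), cap i] :=
    (wordEq_zigzag_left (i := i + 2) (by omega)).context [] [vertex (i + 1), cap i]
      (isTangle_nil n)
  exact ((h1.trans h2).trans h3).trans h4

/-! ### The identities of the calculus as identities of operators -/

/-- One `S` serves all pictures `T`, so each identity of the calculus, stated for fillings of `S`,
transfers to functionals as a whole. -/
theorem exists_surroundings (R : PlanarGraph → K) {p : ℕ} [NeZero p] {n i : ℕ} (h : i + p ≤ n)
    {w u : List Event} (hw : IsTangle 0 w n) (hu : IsTangle n u 0) :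
    ∃ S : Surroundings p, ∀ (T : LocalPicture p) (z : List Event),
      T.events.map (Event.shift i) = z → lowerFunctional R w (z ++ u) = R (S.fill T) := by
  have hn : n = i + p + (n - (i + p)) := by omega
  refine ⟨⟨i, n - (i + p), w, u, hn ▸ hw, hn ▸ hu⟩, ?_⟩
  rintro T _ rfl
  have hT := T.isTangle.shift i (n - (i + p))
  rw [← hn] at hT
  have h1 : IsTangle 0 (w ++ (T.events.map (Event.shift i) ++ u)) 0 := hw.append (hT.append hu)
  have h2 : w ++ (T.events.map (Event.shift i) ++ u) ≠ [] := by
    intro h2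
    simp only [List.append_eq_nil_iff] at h2
    rw [h2.1, isTangle_nil_iff] at hw
    have := NeZero.ne p
    omega
  rw [lowerFunctional, wordValue, dif_pos ⟨h1, h2⟩]
  simp only [Surroundings.fill, List.append_assoc]

/-- The calculus speaks of closed diagrams only; if the upper word does not close, this makes every
term of an identity zero. -/
theorem lowerFunctional_eq_zero {n : ℕ} {w z u : List Event} (hw : IsTangle 0 w n)
    (hz : IsTangle n z n) (hu : ¬ IsTangle n u 0) : lowerFunctional R w (z ++ u) = 0 := by
  refine wordValue_eq_zero fun h => hu ?_
  rw [← List.append_assoc] at h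
  exact (isTangle_append_iff (hw.append hz)).1 h

theorem act_circle {A B a : K} (hR : GraphicalCalculus A B a R) {n i : ℕ} (h : i + 1 ≤ n)
    {φ : List Event → K} (hφ : φ ∈ lowerSpace R n) :
    act [cup i, cap i] φ = mu A B a • φ := by
  refine eqOn_lowerSpace (g := mu A B a • LinearMap.id) (fun w u hw => ?_) hφ
  change lowerFunctional R w ([cup i, cap i] ++ u) =
    mu A B a * lowerFunctional R w ([] ++ u)
  by_cases hu : IsTangle n u 0
  · obtain ⟨S, hS⟩ := exists_surroundings R (p := 1) h hw hu
    have key := hR.circle S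
    rwa [← hS strandWithCircle [cup i, cap i] rfl,
      ← hS strand [] rfl] at key
  · rw [lowerFunctional_eq_zero hw _ hu, lowerFunctional_eq_zero hw _ hu, mul_zero] <;>
    simp only [isTangle_cup_cons, isTangle_cap_cons, isTangle_nil_iff]
    omega

theorem act_loop {A B a : K} (hR : GraphicalCalculus A B a R) {n i : ℕ} (h : i + 1 ≤ n)
    {φ : List Event → K} (hφ : φ ∈ lowerSpace R n) :
    act [cup (i + 1), vertex i, cap (i + 1)] φ = loopCoeff A B a • φ := by
  refine eqOn_lowerSpace (g := loopCoeff A B a • LinearMap.id) (fun w u hw => ?_) hφ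
  change lowerFunctional R w ([cup (i + 1), vertex i, cap (i + 1)] ++ u) =
    loopCoeff A B a * lowerFunctional R w ([] ++ u)
  by_cases hu : IsTangle n u 0
  · obtain ⟨S, hS⟩ := exists_surroundings R (p := 1) h hw hu
    have key := hR.loop S
    rwa [← hS strandWithLoop
        [cup (i + 1), vertex i, cap (i + 1)] rfl,
      ← hS strand [] rfl] at key
  · rw [lowerFunctional_eq_zero hw _ hu, lowerFunctional_eq_zero hw _ hu, mul_zero] <;>
    simp only [isTangle_cup_cons, isTangle_cap_cons, isTangle_vertex_cons, isTangle_nil_iff]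
    omega

theorem act_bigon {A B a : K} (hR : GraphicalCalculus A B a R) {n i : ℕ} (h : i + 2 ≤ n)
    {φ : List Event → K} (hφ : φ ∈ lowerSpace R n) :
    act [vertex i, vertex i] φ = (1 - A * B) • φ + gammaCoeff A B a • act [cap i, cup i] φ
      - (A + B) • act [vertex i] φ := by
  refine eqOn_lowerSpace (g := (1 - A * B) • LinearMap.id + gammaCoeff A B a • act [cap i, cup i]
      - (A + B) • act [vertex i]) (fun w u hw => ?_) hφ
  change lowerFunctional R w ([vertex i, vertex i] ++ u) =
    (1 - A * B) * lowerFunctional R w ([] ++ u)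
      + gammaCoeff A B a * lowerFunctional R w ([cap i, cup i] ++ u)
      - (A + B) * lowerFunctional R w ([vertex i] ++ u)
  by_cases hu : IsTangle n u 0
  · obtain ⟨S, hS⟩ := exists_surroundings R (p := 2) h hw hu
    have key := hR.bigon S
    rwa [← hS bigon [vertex i, vertex i] rfl,
      ← hS alongBigon [] rfl,
      ← hS acrossBigon [cap i, cup i] rfl,
      ← hS crossing [vertex i] rfl] at key
  · have hz : ∀ z, IsTangle n z n → lowerFunctional R w (z ++ u) = 0 := fun z hz =>
      lowerFunctional_eq_zero hw hz hu
    rw [hz, hz, hz, hz]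
    · ring
    all_goals
      simp only [isTangle_cup_cons, isTangle_cap_cons, isTangle_vertex_cons, isTangle_nil_iff,
        and_true]
    all_goals omega

theorem act_triangle {A B a : K} (hR : GraphicalCalculus A B a R) {n i : ℕ} (h : i + 3 ≤ n)
    {φ : List Event → K} (hφ : φ ∈ lowerSpace R n) :
    act [vertex (i + 1), vertex i, vertex (i + 1)] φ =
      act [vertex i, vertex (i + 1), vertex i] φ
      + (A * B) • (act [cap (i + 1), cup (i + 1), vertex i] φ
        - act [cap i, cup i, vertex (i + 1)] φ
        + act [vertex i, cap (i + 1), cup (i + 1)] φ - act [vertex i] φ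
        + act [vertex (i + 1)] φ - act [vertex (i + 1), cap i, cup i] φ)
      + xi A B a • (act [cap i, cup i] φ - act [cap (i + 1), cup (i + 1)] φ) := by
  refine eqOn_lowerSpace (g := act [vertex i, vertex (i + 1), vertex i]
      + (A * B) • (act [cap (i + 1), cup (i + 1), vertex i]
        - act [cap i, cup i, vertex (i + 1)]
        + act [vertex i, cap (i + 1), cup (i + 1)] - act [vertex i]
        + act [vertex (i + 1)] - act [vertex (i + 1), cap i, cup i])
      + xi A B a • (act [cap i, cup i] - act [cap (i + 1), cup (i + 1)]))
      (fun w u hw => ?_) hφ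
  have key : lowerFunctional R w ([vertex (i + 1), vertex i, vertex (i + 1)] ++ u)
      - lowerFunctional R w ([vertex i, vertex (i + 1), vertex i] ++ u) =
      A * B * (lowerFunctional R w ([cap (i + 1), cup (i + 1), vertex i] ++ u)
        - lowerFunctional R w ([cap i, cup i, vertex (i + 1)] ++ u)
        + lowerFunctional R w ([vertex i, cap (i + 1), cup (i + 1)] ++ u)
        - lowerFunctional R w ([vertex i] ++ u)
        + lowerFunctional R w ([vertex (i + 1)] ++ u)
        - lowerFunctional R w ([vertex (i + 1), cap i, cup i] ++ u))
      + xi A B a * (lowerFunctional R w ([cap i, cup i] ++ u)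
        - lowerFunctional R w ([cap (i + 1), cup (i + 1)] ++ u)) := by
    by_cases hu : IsTangle n u 0
    · obtain ⟨S, hS⟩ := exists_surroundings R (p := 3) h hw hu
      have key := hR.triangle S
      rwa [← hS triangle23
          [vertex (i + 1), vertex i, vertex (i + 1)] rfl,
        ← hS triangle12
          [vertex i, vertex (i + 1), vertex i] rfl,
        ← hS arc23 [cap (i + 1), cup (i + 1), vertex i] rfl,
        ← hS arc12 [cap i, cup i, vertex (i + 1)] rfl,
        ← hS arc45 [vertex i, cap (i + 1), cup (i + 1)] rfl,
        ← hS arc34 [vertex i] rfl,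
        ← hS arc61 [vertex (i + 1)] rfl,
        ← hS arc56 [vertex (i + 1), cap i, cup i] rfl,
        ← hS arcs12 [cap i, cup i] rfl,
        ← hS arcs23 [cap (i + 1), cup (i + 1)] rfl] at key
    · have hz : ∀ z, IsTangle n z n → lowerFunctional R w (z ++ u) = 0 := fun z hz =>
        lowerFunctional_eq_zero hw hz hu
      rw [hz, hz, hz, hz, hz, hz, hz, hz, hz, hz]
      · ring
      all_goals
        simp only [isTangle_cup_cons, isTangle_cap_cons, isTangle_vertex_cons, isTangle_nil_iff,
          and_true]
      all_goals omega
  exact eq_add_of_sub_eq' key |>.trans (add_assoc _ _ _).symm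

/-! ### Circles and loops at minima and maxima -/

/-- A circle to the right of a strand. -/
theorem act_circle_right {A B a : K} (hR : GraphicalCalculus A B a R) {n i : ℕ} (h : i + 1 ≤ n)
    {φ : List Event → K} (hφ : φ ∈ lowerSpace R n) :
    act [cup (i + 1), cap (i + 1)] φ = mu A B a • φ := by
  -- The strand is bent into a zigzag; a circle on its right is then on the left of the middle
  -- segment, where the circle identity applies.
  have h1 : WordEq R n [cup i, cup (i + 1), cap (i + 1), cap (i + 1)]
      [cup i, cup (i + 1), cap (i + 3), cap (i + 1)] :=
    (wordEq_cap_cap (n := n + 4) (i := i + 1) (d := 0) (by omega)).context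
      [cup i, cup (i + 1)] []
      (by simp only [isTangle_cup_cons, isTangle_nil_iff, and_true]; omega)
  have h2 : WordEq R n [cup i, cup (i + 1), cap (i + 3), cap (i + 1)]
      [cup i, cap (i + 1), cup (i + 1), cap (i + 1)] :=
    (wordEq_cup_cap (n := n + 2) (i := i + 1) (d := 0) (by omega)).context
      [cup i] [cap (i + 1)]
      (by simp only [isTangle_cup_cons, isTangle_nil_iff, and_true]; omega)
  have h3 : WordEq R n [cup i, cap (i + 1), cup (i + 1), cap (i + 1)]
      [cup (i + 1), cap (i + 1)] :=
    (wordEq_zigzag_left h).context [] [cup (i + 1), cap (i + 1)] (isTangle_nil n)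
  rw [← ((h1.trans h2).trans h3) φ hφ]
  change act [cap (i + 1)] (act [cup (i + 1), cap (i + 1)] (act [cup i] φ)) = _
  rw [act_circle hR (n := n + 2) (by omega)
    (act_mem_lowerSpace (by simp only [isTangle_cup_cons, isTangle_nil_iff, and_true]; omega) hφ),
    map_smul]
  exact congrArg _ (wordEq_zigzag_left h φ hφ)

/-- The circle identity needs a strand nearby, and `n` may be zero: the upper minimum is first slid
below the circle to provide one. -/
theorem act_cup_cap_cup {A B a : K} (hR : GraphicalCalculus A B a R) {n i : ℕ} (h : i ≤ n)
    {φ : List Event → K} (hφ : φ ∈ lowerSpace R n) :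
    act [cup i, cap i, cup i] φ = mu A B a • act [cup i] φ := by
  have h1 : WordEq R n [cup i, cap i, cup i] [cup i, cup (i + 2), cap i] :=
    (wordEq_cap_cup (n := n + 2) (d := 0) (by omega)).context [cup i] []
      (by simp only [isTangle_cup_cons, isTangle_nil_iff, and_true]; omega)
  have h2 : WordEq R n [cup i, cup (i + 2), cap i] [cup i, cup i, cap i] :=
    (wordEq_cup_cup (d := 0) (by omega)).context [] [cap i] (isTangle_nil n)
  rw [(h1.trans h2) φ hφ]
  exact act_circle hR (n := n + 2) (i := i) (φ := act [cup i] φ) (by omega)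
    (act_mem_lowerSpace (by simp only [isTangle_cup_cons, isTangle_nil_iff, and_true]; omega) hφ)

/-- A quarter turn of the vertex shows the curl as a loop on the right leg of the minimum. -/
theorem act_cup_vertex {A B a : K} (hR : GraphicalCalculus A B a R) {n i : ℕ} (h : i ≤ n)
    {φ : List Event → K} (hφ : φ ∈ lowerSpace R n) :
    act [cup i, vertex i] φ = loopCoeff A B a • act [cup i] φ := by
  have h1 : WordEq R n [cup i, vertex i] [cup i, cup i, vertex (i + 1), cap (i + 2)] :=
    ((wordEq_turn_right (n := n + 2) (by omega)).context [cup i] []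
      (by simp only [isTangle_cup_cons, isTangle_nil_iff, and_true]; omega)).symm
  have h2 : WordEq R n [cup i, cup i, vertex (i + 1), cap (i + 2)]
      [cup i, cup (i + 2), vertex (i + 1), cap (i + 2)] :=
    ((wordEq_cup_cup (d := 0) (by omega)).context [] [vertex (i + 1), cap (i + 2)]
      (isTangle_nil n)).symm
  rw [(h1.trans h2) φ hφ]
  exact act_loop hR (n := n + 2) (i := i + 1) (φ := act [cup i] φ) (by omega)
    (act_mem_lowerSpace (by simp only [isTangle_cup_cons, isTangle_nil_iff, and_true]; omega) hφ)

theorem act_vertex_cap {A B a : K} (hR : GraphicalCalculus A B a R) {n i : ℕ} (h : i + 2 ≤ n)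
    {φ : List Event → K} (hφ : φ ∈ lowerSpace R n) :
    act [vertex i, cap i] φ = loopCoeff A B a • act [cap i] φ := by
  have h1 : WordEq R n [vertex i, cap i] [cup (i + 2), vertex (i + 1), cap i, cap i] :=
    ((wordEq_turn_left h).context [] [cap i] (isTangle_nil n)).symm
  have h2 : WordEq R n [cup (i + 2), vertex (i + 1), cap i, cap i]
      [cup (i + 2), vertex (i + 1), cap (i + 2), cap i] :=
    (wordEq_cap_cap (n := n + 2) (d := 0) (by omega)).context [cup (i + 2), vertex (i + 1)] []
      (by simp only [isTangle_cup_cons, isTangle_vertex_cons, isTangle_nil_iff, and_true]; omega)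
  rw [(h1.trans h2) φ hφ]
  change act [cap i] (act [cup (i + 1 + 1), vertex (i + 1), cap (i + 1 + 1)] φ) = _
  rw [act_loop hR (by omega) hφ, map_smul]

/-! ### The tangle algebra generated by vertices and hooks -/

theorem map_mem_of_mem_span {s : Set (List Event → K)} {S : Submodule K (List Event → K)}
    (f : (List Event → K) →ₗ[K] (List Event → K)) (h : ∀ x ∈ s, f x ∈ S) {x : List Event → K}
    (hx : x ∈ Submodule.span K s) : f x ∈ S :=
  (Submodule.span_le (p := S.comap f)).2 h hx

/-- The generators of the tangle algebra in position `i`: a vertex, or a maximum followed by a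
minimum. -/
def letters (i : ℕ) : Set (List Event) := {[vertex i], [cap i, cup i]}

/-- Words in the generators of the tangle algebra on the first `n` strands. -/
inductive AlgebraWord (n : ℕ) : List Event → Prop
  | nil : AlgebraWord n []
  | snoc {w x : List Event} {i : ℕ} : AlgebraWord n w → i + 2 ≤ n → x ∈ letters i →
      AlgebraWord n (w ++ x)

theorem isTangle_letter {n i : ℕ} {x : List Event} (h : i + 2 ≤ n) (hx : x ∈ letters i) :
    IsTangle n x n := by
  rcases hx with rfl | rfl
  · exact isTangle_vertex_cons.2 ⟨h, rfl⟩
  · simp only [isTangle_cup_cons, isTangle_cap_cons, isTangle_nil_iff]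
    omega

theorem AlgebraWord.isTangle {n m : ℕ} {w : List Event} (hw : AlgebraWord n w) (h : n ≤ m) :
    IsTangle m w m := by
  induction hw with
  | nil => rfl
  | snoc _ hi hx ih => exact ih.append (isTangle_letter (by omega) hx)

theorem AlgebraWord.mono {n m : ℕ} {w : List Event} (hw : AlgebraWord n w) (h : n ≤ m) :
    AlgebraWord m w := by
  induction hw with
  | nil => exact .nil
  | snoc _ hi hx ih => exact ih.snoc (by omega) hx

theorem AlgebraWord.append {n : ℕ} {w z : List Event} (hw : AlgebraWord n w)
    (hz : AlgebraWord n z) : AlgebraWord n (w ++ z) := by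
  induction hz with
  | nil => simpa using hw
  | snoc _ hi hx ih => rw [← List.append_assoc]; exact ih.snoc hi hx

theorem AlgebraWord.of_letter {n i : ℕ} {x : List Event} (h : i + 2 ≤ n) (hx : x ∈ letters i) :
    AlgebraWord n x :=
  AlgebraWord.nil.snoc h hx

theorem AlgebraWord.vertex {n i : ℕ} (h : i + 2 ≤ n) : AlgebraWord n [vertex i] :=
  .of_letter h (.inl rfl)

theorem AlgebraWord.hook {n i : ℕ} (h : i + 2 ≤ n) : AlgebraWord n [cap i, cup i] :=
  .of_letter h (.inr rfl)

theorem AlgebraWord.eq_nil {w : List Event} (hw : AlgebraWord 1 w) : w = [] := by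
  cases hw with
  | nil => rfl
  | snoc _ h _ => omega

/-- Far commutativity: `w` lives on the first `k + 1` strands, the letter on the next two. -/
theorem wordEq_letter_right {k n : ℕ} {w x : List Event} (hw : AlgebraWord (k + 1) w)
    (h : k + 3 ≤ n) (hx : x ∈ insert [] (letters (k + 1))) : WordEq R n (w ++ x) (x ++ w) := by
  rcases hx with rfl | hx
  · simpa using WordEq.refl n w
  · refine wordEq_word_right (hw.isTangle le_rfl) (isTangle_letter h hx) ?_ (by omega)
    rcases hx with rfl | rfl <;> simp [PlanarCalculus.vertex, cap, cup]

/-! ### Reduction to one occurrence of the last generator -/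

/-- The span of the translates of `φ` by words in which the last generator of the tangle algebra
on `n + 2` strands occurs at most once. -/
def sandwich (n : ℕ) (φ : List Event → K) : Submodule K (List Event → K) :=
  Submodule.span K {ψ | ∃ p z q, AlgebraWord (n + 1) p ∧ z ∈ insert [] (letters n) ∧
    AlgebraWord (n + 1) q ∧ ψ = act (p ++ z ++ q) φ}

theorem act_mem_sandwich_of_mem {n : ℕ} {φ ψ : List Event → K} {q : List Event}
    (hq : AlgebraWord (n + 1) q) (hψ : ψ ∈ sandwich n φ) : act q ψ ∈ sandwich n φ := by
  refine map_mem_of_mem_span _ ?_ hψ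
  rintro _ ⟨p, z, r, hp, hz, hr, rfl⟩
  exact Submodule.subset_span ⟨p, z, r ++ q, hp, hz, hr.append hq, by simp only [act_append]⟩

theorem sandwich_act_le {n : ℕ} {φ : List Event → K} {p : List Event}
    (hp : AlgebraWord (n + 1) p) : sandwich n (act p φ) ≤ sandwich n φ := by
  refine Submodule.span_le.2 ?_
  rintro _ ⟨r, z, q, hr, hz, hq, rfl⟩
  exact Submodule.subset_span ⟨p ++ r, z, q, hp.append hr, hz, hq, by simp only [act_append]⟩

theorem sandwich_intro {n : ℕ} {φ : List Event → K} (p z q : List Event)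
    (hp : AlgebraWord (n + 1) p) (hz : z ∈ insert [] (letters n)) (hq : AlgebraWord (n + 1) q) :
    act (p ++ z ++ q) φ ∈ sandwich n φ :=
  Submodule.subset_span ⟨p, z, q, hp, hz, hq, rfl⟩

theorem vertex_mem_letters (i : ℕ) : [vertex i] ∈ insert [] (letters i) := .inr (.inl rfl)

theorem hook_mem_letters (i : ℕ) : [cap i, cup i] ∈ insert [] (letters i) := .inr (.inr rfl)

theorem act_letter_mem_sandwich {n : ℕ} {φ : List Event → K} {x : List Event}
    (hx : x ∈ insert [] (letters n)) : act x φ ∈ sandwich n φ := by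
  have := sandwich_intro (φ := φ) [] x [] .nil hx (.nil (n := n + 1))
  simpa using this

theorem act_letter_letter_mem_sandwich {A B a : K} (hR : GraphicalCalculus A B a R) {n N : ℕ}
    (h : n + 2 ≤ N) {φ : List Event → K} (hφ : φ ∈ lowerSpace R N) {x x' : List Event}
    (hx : x ∈ insert [] (letters n)) (hx' : x' ∈ letters n) :
    act (x ++ x') φ ∈ sandwich n φ := by
  have hcap : act [cap n] φ ∈ lowerSpace R (N - 2) :=
    act_mem_lowerSpace (by simp only [isTangle_cap_cons, isTangle_nil_iff, and_true]; omega) hφ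
  rcases hx with rfl | rfl | rfl
  · exact act_letter_mem_sandwich (.inr hx')
  · rcases hx' with rfl | rfl
    · change act [vertex n, vertex n] φ ∈ _
      rw [act_bigon hR h hφ]
      exact sub_mem (add_mem (Submodule.smul_mem _ _ (act_letter_mem_sandwich (.inl rfl)))
        (Submodule.smul_mem _ _ (act_letter_mem_sandwich (hook_mem_letters n))))
        (Submodule.smul_mem _ _ (act_letter_mem_sandwich (vertex_mem_letters n)))
    · change act [cup n] (act [vertex n, cap n] φ) ∈ _
      rw [act_vertex_cap hR h hφ, map_smul]
      exact Submodule.smul_mem _ _ (act_letter_mem_sandwich (hook_mem_letters n))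
  · rcases hx' with rfl | rfl
    · change act [cup n, vertex n] (act [cap n] φ) ∈ _
      rw [act_cup_vertex hR (n := N - 2) (by omega) hcap]
      exact Submodule.smul_mem _ _ (act_letter_mem_sandwich (hook_mem_letters n))
    · change act [cup n, cap n, cup n] (act [cap n] φ) ∈ _
      rw [act_cup_cap_cup hR (n := N - 2) (by omega) hcap]
      exact Submodule.smul_mem _ _ (act_letter_mem_sandwich (hook_mem_letters n))

theorem wordEq_hook_vertex_vertex {n i : ℕ} (h : i + 3 ≤ n) :
    WordEq R n [cap (i + 1), cup (i + 1), vertex i] [cap (i + 1), cup i, vertex (i + 1)] :=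
  (wordEq_cup_vertex (n := n - 2) (by omega)).context [cap (i + 1)] []
    (by simp only [isTangle_cap_cons, isTangle_nil_iff, and_true]; omega)

theorem wordEq_vertex_hook {n i : ℕ} (h : i + 3 ≤ n) (q : List Event) :
    WordEq R n (vertex i :: cap (i + 1) :: q) (vertex (i + 1) :: cap i :: q) :=
  (wordEq_vertex_cap_slide h).context [] q (isTangle_nil n)

/-- The local relations on three strands: two letters in the last position with at most one letter
`y` in the previous position between them. With a vertex as `y`, the triangle, bigon and loop
identities are needed; with a hook, isotopy alone suffices. -/
theorem act_letter_core_letter_mem_sandwich {A B a : K} (hR : GraphicalCalculus A B a R)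
    {k N : ℕ} (h : k + 3 ≤ N) {φ : List Event → K} (hφ : φ ∈ lowerSpace R N)
    {x y x' : List Event} (hx : x ∈ insert [] (letters (k + 1)))
    (hy : y ∈ insert [] (letters k)) (hx' : x' ∈ letters (k + 1)) :
    act (x ++ y ++ x') φ ∈ sandwich (k + 1) φ := by
  have hcap : act [cap (k + 1)] φ ∈ lowerSpace R (N - 2) :=
    act_mem_lowerSpace (by simp only [isTangle_cap_cons, isTangle_nil_iff, and_true]; omega) hφ
  have aV : AlgebraWord (k + 1 + 1) [vertex k] := .vertex (by omega)
  have aH : AlgebraWord (k + 1 + 1) [cap k, cup k] := .hook (by omega)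
  have lV := vertex_mem_letters (k + 1)
  have lH := hook_mem_letters (k + 1)
  rcases hy with rfl | hy
  · simpa using act_letter_letter_mem_sandwich hR h hφ hx hx'
  rcases hx with rfl | hx
  · simpa using sandwich_intro (φ := φ) y x' [] (.of_letter (by omega) hy) (.inr hx') .nil
  rcases hy with rfl | rfl
  · rcases hx with rfl | rfl <;> rcases hx' with rfl | rfl
    · change act [vertex (k + 1), vertex k, vertex (k + 1)] φ ∈ _
      rw [act_triangle hR h hφ]
      refine add_mem (add_mem ?_ (Submodule.smul_mem _ _ (sub_mem (add_mem (sub_mem (add_mem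
        (sub_mem ?_ ?_) ?_) ?_) ?_) ?_))) (Submodule.smul_mem _ _ (sub_mem ?_ ?_))
      · exact sandwich_intro [vertex k] _ [vertex k] aV lV aV
      · exact sandwich_intro [] _ [vertex k] .nil lH aV
      · exact sandwich_intro [cap k, cup k] [vertex (k + 1)] [] aH lV .nil
      · exact sandwich_intro [vertex k] [cap (k + 1), cup (k + 1)] [] aV lH .nil
      · exact sandwich_intro [vertex k] [] [] aV (.inl rfl) .nil
      · exact sandwich_intro [] _ [] .nil lV .nil
      · exact sandwich_intro [] [vertex (k + 1)] [cap k, cup k] .nil lV aH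
      · exact sandwich_intro [cap k, cup k] [] [] aH (.inl rfl) .nil
      · exact sandwich_intro [] _ [] .nil lH .nil
    -- Sliding the second vertex across the maximum puts it on top of the first, forming a bigon.
    · have h1 : act [vertex (k + 1), vertex k, cap (k + 1), cup (k + 1)] φ =
          act [cap k, cup (k + 1)] (act [vertex (k + 1), vertex (k + 1)] φ) :=
        (wordEq_vertex_hook h [cup (k + 1)]).context [vertex (k + 1)] []
          (isTangle_vertex_cons.2 ⟨by omega, rfl⟩) φ hφ
      have h2 : act [cap (k + 1), cup (k + 1), cap k, cup (k + 1)] φ =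
          act [cap (k + 1), cup (k + 1)] φ :=
        (wordEq_zigzag_right (n := N - 2) (by omega)).context [cap (k + 1)] [cup (k + 1)]
          (by simp only [isTangle_cap_cons, isTangle_nil_iff, and_true]; omega) φ hφ
      have h3 : act [cap k, cup k, cap (k + 1), cup (k + 1)] φ = act [cap k, cup (k + 1)] φ :=
        (wordEq_zigzag_left (n := N - 2) (by omega)).context [cap k] [cup (k + 1)]
          (by simp only [isTangle_cap_cons, isTangle_nil_iff, and_true]; omega) φ hφ
      have h4 := wordEq_vertex_hook h [cup (k + 1)] φ hφ
      change act [vertex (k + 1), vertex k, cap (k + 1), cup (k + 1)] φ ∈ _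
      rw [h1, act_bigon hR h hφ, map_sub, map_add, map_smul, map_smul, map_smul,
        ← act_append, ← act_append]
      refine sub_mem (add_mem (Submodule.smul_mem _ _ ?_) (Submodule.smul_mem _ _ ?_))
        (Submodule.smul_mem _ _ ?_)
      · rw [← h3]
        exact sandwich_intro [cap k, cup k] [cap (k + 1), cup (k + 1)] [] aH lH .nil
      · rw [List.cons_append, List.cons_append, List.nil_append, h2]
        exact act_letter_mem_sandwich lH
      · rw [List.cons_append, List.nil_append, ← h4]
        exact sandwich_intro [vertex k] [cap (k + 1), cup (k + 1)] [] aV lH .nil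
    -- The same, upside down: the lower vertex slides across the minimum.
    · have h1 : act [cap (k + 1), cup (k + 1), vertex k, vertex (k + 1)] φ =
          act [vertex (k + 1), vertex (k + 1)] (act [cap (k + 1), cup k] φ) :=
        (wordEq_hook_vertex_vertex h).context [] [vertex (k + 1)] (isTangle_nil N) φ hφ
      have h2 : act [cap (k + 1), cup k, cap (k + 1), cup (k + 1)] φ =
          act [cap (k + 1), cup (k + 1)] φ :=
        (wordEq_zigzag_left (n := N - 2) (by omega)).context [cap (k + 1)] [cup (k + 1)]
          (by simp only [isTangle_cap_cons, isTangle_nil_iff, and_true]; omega) φ hφ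
      have h3 : act [cap (k + 1), cup (k + 1), cap k, cup k] φ = act [cap (k + 1), cup k] φ :=
        (wordEq_zigzag_right (n := N - 2) (by omega)).context [cap (k + 1)] [cup k]
          (by simp only [isTangle_cap_cons, isTangle_nil_iff, and_true]; omega) φ hφ
      have h4 := wordEq_hook_vertex_vertex h φ hφ
      change act [cap (k + 1), cup (k + 1), vertex k, vertex (k + 1)] φ ∈ _
      rw [h1, act_bigon hR (n := N) h (act_mem_lowerSpace
        (by simp only [isTangle_cap_cons, isTangle_cup_cons, isTangle_nil_iff]; omega) hφ),
        ← act_append, ← act_append]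
      refine sub_mem (add_mem (Submodule.smul_mem _ _ ?_) (Submodule.smul_mem _ _ ?_))
        (Submodule.smul_mem _ _ ?_)
      · rw [← h3]
        exact sandwich_intro [] [cap (k + 1), cup (k + 1)] [cap k, cup k] .nil lH aH
      · rw [List.cons_append, List.cons_append, List.nil_append, h2]
        exact act_letter_mem_sandwich lH
      · rw [List.cons_append, List.cons_append, List.nil_append, ← h4]
        exact sandwich_intro [] [cap (k + 1), cup (k + 1)] [vertex k] .nil lH aV
    · change act [cup (k + 1)] (act [cup (k + 1), vertex k, cap (k + 1)] (act [cap (k + 1)] φ)) ∈ _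
      rw [act_loop hR (n := N - 2) (by omega) hcap, map_smul]
      exact Submodule.smul_mem _ _ (act_letter_mem_sandwich lH)
  · rcases hx with rfl | rfl <;> rcases hx' with rfl | rfl
    -- Both vertices slide to position `k`, and the hook between them moves to position `k + 1`.
    · have h1 : act [vertex (k + 1), cap k, cup k, vertex (k + 1)] φ =
          act [vertex k, cap (k + 1), cup k, vertex (k + 1)] φ :=
        (wordEq_vertex_hook h _).symm φ hφ
      have h2 : act [vertex k, cap (k + 1), cup (k + 1), vertex k] φ =
          act [vertex k, cap (k + 1), cup k, vertex (k + 1)] φ :=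
        (wordEq_hook_vertex_vertex (n := N) h).context [vertex k] []
          (isTangle_vertex_cons.2 ⟨by omega, rfl⟩) φ hφ
      change act [vertex (k + 1), cap k, cup k, vertex (k + 1)] φ ∈ _
      rw [h1, ← h2]
      exact sandwich_intro [vertex k] [cap (k + 1), cup (k + 1)] [vertex k] aV lH aV
    · have h1 : act [vertex (k + 1), cap k, cup k, cap (k + 1), cup (k + 1)] φ =
          act [vertex (k + 1), cap k, cup (k + 1)] φ :=
        (wordEq_zigzag_left (n := N - 2) (by omega)).context [vertex (k + 1), cap k]
          [cup (k + 1)] (by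
            simp only [isTangle_vertex_cons, isTangle_cap_cons, isTangle_nil_iff, and_true]
            omega) φ hφ
      have h4 := wordEq_vertex_hook h [cup (k + 1)] φ hφ
      change act [vertex (k + 1), cap k, cup k, cap (k + 1), cup (k + 1)] φ ∈ _
      rw [h1, ← h4]
      exact sandwich_intro [vertex k] [cap (k + 1), cup (k + 1)] [] aV lH .nil
    · have h1 : act [cap (k + 1), cup (k + 1), cap k, cup k, vertex (k + 1)] φ =
          act [cap (k + 1), cup k, vertex (k + 1)] φ :=
        (wordEq_zigzag_right (n := N - 2) (by omega)).context [cap (k + 1)]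
          [cup k, vertex (k + 1)]
          (by simp only [isTangle_cap_cons, isTangle_nil_iff, and_true]; omega) φ hφ
      have h4 := wordEq_hook_vertex_vertex h φ hφ
      change act [cap (k + 1), cup (k + 1), cap k, cup k, vertex (k + 1)] φ ∈ _
      rw [h1, ← h4]
      exact sandwich_intro [] [cap (k + 1), cup (k + 1)] [vertex k] .nil lH aV
    · have h1 : act [cap (k + 1), cup (k + 1), cap k, cup k, cap (k + 1), cup (k + 1)] φ =
          act [cap (k + 1), cup k, cap (k + 1), cup (k + 1)] φ :=
        (wordEq_zigzag_right (n := N - 2) (by omega)).context [cap (k + 1)]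
          [cup k, cap (k + 1), cup (k + 1)]
          (by simp only [isTangle_cap_cons, isTangle_nil_iff, and_true]; omega) φ hφ
      have h2 : act [cap (k + 1), cup k, cap (k + 1), cup (k + 1)] φ =
          act [cap (k + 1), cup (k + 1)] φ :=
        (wordEq_zigzag_left (n := N - 2) (by omega)).context [cap (k + 1)] [cup (k + 1)]
          (by simp only [isTangle_cap_cons, isTangle_nil_iff, and_true]; omega) φ hφ
      change act [cap (k + 1), cup (k + 1), cap k, cup k, cap (k + 1), cup (k + 1)] φ ∈ _
      rw [h1, h2]
      exact act_letter_mem_sandwich lH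

/-- Induction on the number of strands and on the word. When a new last letter `x` meets `p z q`,
the middle part `q` has itself the form `r y s` by induction. Here `r` commutes with `z` and `s`
with `x`, so `p z r y s x` becomes `p r (z y x) s`, and the local relations apply to `z y x`. -/
theorem act_mem_sandwich {A B a : K} (hR : GraphicalCalculus A B a R) {n N : ℕ}
    (h : n + 2 ≤ N) {φ : List Event → K} (hφ : φ ∈ lowerSpace R N) {w : List Event}
    (hw : AlgebraWord (n + 2) w) : act w φ ∈ sandwich n φ := by
  induction n generalizing φ w with
  | zero =>
    induction hw with
    | nil => exact act_letter_mem_sandwich (.inl rfl)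
    | @snoc w x i _ hi hx ih =>
      obtain rfl : i = 0 := by omega
      rw [act_append]
      refine map_mem_of_mem_span _ ?_ ih
      rintro _ ⟨p, z, q, hp, hz, hq, rfl⟩
      rw [hp.eq_nil, hq.eq_nil, ← act_append]
      simpa using act_letter_letter_mem_sandwich hR h hφ hz hx
  | succ k ihk =>
    induction hw with
    | nil => exact act_letter_mem_sandwich (.inl rfl)
    | @snoc w x i _ hi hx ih =>
      rw [act_append]
      by_cases hik : i ≤ k
      · exact act_mem_sandwich_of_mem (.of_letter (by omega) hx) ih
      obtain rfl : i = k + 1 := by omega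
      refine map_mem_of_mem_span _ ?_ ih
      rintro _ ⟨p, z, q, hp, hz, hq, rfl⟩
      have hpN := act_mem_lowerSpace (hp.isTangle (m := N) (by omega)) hφ
      have hzN : IsTangle N z N := by
        rcases hz with rfl | hz
        · rfl
        · exact isTangle_letter (by omega) hz
      have hpz := act_mem_lowerSpace hzN hpN
      rw [act_append, act_append]
      refine map_mem_of_mem_span _ ?_ (ihk (by omega) hpz hq)
      rintro _ ⟨r, y, s, hr, hy, hs, rfl⟩
      have hyN : IsTangle N y N := by
        rcases hy with rfl | hy
        · rfl
        · exact isTangle_letter (by omega) hy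
      have hrN : IsTangle N r N := hr.isTangle (by omega)
      have e1 : act (s ++ x) (act y (act r (act z (act p φ)))) = _ :=
        wordEq_letter_right hs (by omega) (.inr hx) _
          (act_mem_lowerSpace hyN (act_mem_lowerSpace hrN hpz))
      have e2 : act (z ++ r) (act p φ) = _ :=
        ((wordEq_letter_right hr (by omega) hz).symm) _ hpN
      simp only [act_append] at e1 e2 ⊢
      rw [e1, e2]
      refine act_mem_sandwich_of_mem (hs.mono (by omega)) ?_
      refine sandwich_act_le hp (sandwich_act_le (hr.mono (by omega)) ?_)
      have := act_letter_core_letter_mem_sandwich hR (N := N) (by omega)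
        (act_mem_lowerSpace hrN hpN) hz hy hx
      simpa only [act_append] using this

/-! ### Normal form and its stability under all events -/

/-- The span of the functionals in normal form: the last strand comes from the topmost local
minimum, and only generators of the tangle algebra on the other strands follow. -/
noncomputable def normalSpace (R : PlanarGraph → K) : ℕ → Submodule K (List Event → K)
  -- The circle identity requires a strand, so a lone circle is not a multiple of the empty word by
  -- the calculus. On one strand the space is zero, since events preserve the parity of the number
  -- of strands.
  | 0 => Submodule.span K {lowerFunctional R [], lowerFunctional R [cup 0, cap 0]}
  | 1 => ⊥
  | n + 2 => Submodule.span K {ψ | ∃ φ ∈ normalSpace R n, ∃ w, AlgebraWord (n + 1) w ∧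
      ψ = act (cup n :: w) φ}

theorem isTangle_cup {n i : ℕ} (h : i ≤ n) : IsTangle n [cup i] (n + 2) :=
  isTangle_cup_cons.2 ⟨h, rfl⟩

theorem normalSpace_le (R : PlanarGraph → K) (n : ℕ) : normalSpace R n ≤ lowerSpace R n := by
  induction n using Nat.twoStepInduction with
  | zero =>
    refine Submodule.span_le.2 ?_
    rintro _ (rfl | rfl)
    · exact Submodule.subset_span ⟨[], rfl, rfl⟩
    · exact Submodule.subset_span ⟨[cup 0, cap 0], rfl, rfl⟩
  | one => exact bot_le
  | more n ih _ =>
    refine Submodule.span_le.2 ?_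
    rintro _ ⟨φ, hφ, w, hw, rfl⟩
    exact act_mem_lowerSpace (isTangle_cup_cons.2 ⟨le_rfl, hw.isTangle (by omega)⟩) (ih hφ)

theorem act_cup_append_mem_normalSpace {n : ℕ} {φ : List Event → K} (hφ : φ ∈ normalSpace R n)
    {w : List Event} (hw : AlgebraWord (n + 1) w) : act (cup n :: w) φ ∈ normalSpace R (n + 2) :=
  Submodule.subset_span ⟨φ, hφ, w, hw, rfl⟩

theorem act_cup_letter_mem_normalSpace {A B a : K} (hR : GraphicalCalculus A B a R) {n : ℕ}
    {φ : List Event → K} (hφ : φ ∈ normalSpace R n) {x : List Event} (hx : x ∈ letters n) :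
    act (cup n :: x) φ ∈ normalSpace R (n + 2) := by
  have hcup := act_cup_append_mem_normalSpace hφ .nil
  rcases hx with rfl | rfl
  · rw [act_cup_vertex hR le_rfl (normalSpace_le R n hφ)]
    exact Submodule.smul_mem _ _ hcup
  · rw [act_cup_cap_cup hR le_rfl (normalSpace_le R n hφ)]
    exact Submodule.smul_mem _ _ hcup

/-- The local case of stability under the last letter `x`. Two vertices become a bigon after the
lower one slides across the minimum; a vertex and a hook contain a loop; a hook as `y` straightens
against the minimum. -/
theorem act_cup_core_letter_mem_normalSpace {A B a : K} (hR : GraphicalCalculus A B a R)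
    {k : ℕ} {φ : List Event → K} (hφ : φ ∈ normalSpace R (k + 1)) {x y : List Event}
    (hy : y ∈ insert [] (letters k)) (hx : x ∈ letters (k + 1)) :
    act (cup (k + 1) :: (y ++ x)) φ ∈ normalSpace R (k + 3) := by
  have hφ' := normalSpace_le R _ hφ
  have hcup : act [cup (k + 1)] φ ∈ normalSpace R (k + 3) :=
    act_cup_append_mem_normalSpace hφ .nil
  have hV : act [cup k, vertex (k + 1)] φ ∈ normalSpace R (k + 3) := by
    rw [← wordEq_cup_vertex le_rfl φ hφ']
    exact act_cup_append_mem_normalSpace hφ (.vertex (by omega))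
  have hH (q : List Event) : act (cup (k + 1) :: cap k :: cup k :: q) φ = act (cup k :: q) φ :=
    (wordEq_zigzag_right le_rfl).context [] (cup k :: q) (isTangle_nil _) φ hφ'
  have hZ : act [cup k, cap (k + 1), cup (k + 1)] φ = act [cup (k + 1)] φ :=
    (wordEq_zigzag_left le_rfl).context [] [cup (k + 1)] (isTangle_nil _) φ hφ'
  rcases hy with rfl | rfl | rfl
  · exact act_cup_letter_mem_normalSpace hR hφ hx
  · rcases hx with rfl | rfl
    · have h1 : act [cup (k + 1), vertex k, vertex (k + 1)] φ =
          act [vertex (k + 1), vertex (k + 1)] (act [cup k] φ) :=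
        (wordEq_cup_vertex le_rfl).context [] [vertex (k + 1)] (isTangle_nil _) φ hφ'
      change act [cup (k + 1), vertex k, vertex (k + 1)] φ ∈ _
      rw [h1, act_bigon hR (n := k + 3) (by omega)
        (act_mem_lowerSpace (isTangle_cup (by omega)) hφ'), ← act_append, ← act_append]
      refine sub_mem (add_mem (Submodule.smul_mem _ _ ?_) (Submodule.smul_mem _ _ ?_))
        (Submodule.smul_mem _ _ hV)
      · rw [← hH]
        exact act_cup_append_mem_normalSpace hφ (.hook (by omega))
      · rw [List.cons_append, List.nil_append, hZ]
        exact hcup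
    · change act [cup (k + 1)] (act [cup (k + 1), vertex k, cap (k + 1)] φ) ∈ _
      rw [act_loop hR le_rfl hφ', map_smul]
      exact Submodule.smul_mem _ _ hcup
  · rw [List.cons_append, List.cons_append, List.nil_append, hH]
    rcases hx with rfl | rfl
    · exact hV
    · rw [hZ]
      exact hcup

/-- Only a letter touching the last strand is not absorbed at once. The word before it is written as
`r y s` with at most one letter `y` in its own last position, which isolates the local configuration
of minimum, `y` and new letter. -/
theorem act_algebraWord_mem_normalSpace {A B a : K} (hR : GraphicalCalculus A B a R) {n : ℕ}
    {φ : List Event → K} (hφ : φ ∈ normalSpace R n) {w : List Event} (hw : AlgebraWord n w) :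
    act w φ ∈ normalSpace R n := by
  induction n using Nat.twoStepInduction generalizing φ w with
  | zero =>
    rw [(hw.mono zero_le_one).eq_nil]
    exact hφ
  | one =>
    rw [hw.eq_nil]
    exact hφ
  | more n ihn _ =>
    induction hw with
    | nil => exact hφ
    | @snoc w x i _ hi hx ih =>
      rw [act_append]
      refine map_mem_of_mem_span _ ?_ ih
      rintro _ ⟨θ, hθ, z, hz, rfl⟩
      by_cases hin : i + 1 ≤ n
      · rw [← act_append]
        exact act_cup_append_mem_normalSpace hθ (hz.snoc (by omega) hx)
      obtain rfl : i = n := by omega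
      rcases i with _ | k
      · rw [hz.eq_nil, ← act_append]
        exact act_cup_letter_mem_normalSpace hR hθ hx
      have hθ' := normalSpace_le R _ hθ
      rw [act_cons]
      refine map_mem_of_mem_span _ ?_ (act_mem_sandwich hR (n := k) (N := k + 3) (by omega)
        (act_mem_lowerSpace (isTangle_cup le_rfl) hθ') hz)
      rintro _ ⟨r, y, s, hr, hy, hs, rfl⟩
      have hr' := ihn hθ hr
      have hrT := hr.isTangle le_rfl
      have hyT : IsTangle (k + 3) y (k + 3) := by
        rcases hy with rfl | hy
        · rfl
        · exact isTangle_letter (by omega) hy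
      -- `r` uses only strands that exist before the minimum, so it slides below it and is absorbed
      -- by the induction hypothesis; `s` commutes with the new letter.
      have e1 : act (r ++ [cup (k + 1)]) θ = act ([cup (k + 1)] ++ r) θ :=
        wordEq_word_right hrT (isTangle_cup le_rfl) (by simp [cup]) le_rfl θ hθ'
      have e2 : act (s ++ x) (act (r ++ [cup (k + 1)] ++ y) θ) = _ :=
        wordEq_letter_right hs le_rfl (.inr hx) _
          (act_mem_lowerSpace ((hrT.append (isTangle_cup le_rfl)).append hyT) hθ')
      simp only [act_append] at e1 e2 ⊢
      rw [← e1, e2]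
      have key := act_cup_core_letter_mem_normalSpace hR hr' hy hx
      rw [act_cons, act_append] at key
      refine map_mem_of_mem_span _ ?_ key
      rintro _ ⟨χ, hχ, z', hz', rfl⟩
      rw [← act_append]
      exact act_cup_append_mem_normalSpace hχ (hz'.append (hs.mono (by omega)))

/-- A minimum one place further left arises from a hook above the given one, by straightening a
zigzag. -/
theorem act_cup_mem_normalSpace {A B a : K} (hR : GraphicalCalculus A B a R) {n i : ℕ}
    (h : i ≤ n) {φ : List Event → K} (hφ : φ ∈ normalSpace R n) :
    act [cup i] φ ∈ normalSpace R (n + 2) := by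
  induction h using Nat.decreasingInduction with
  | self => exact act_cup_append_mem_normalSpace hφ .nil
  | of_succ i hi ih =>
    have h1 : act [cup (i + 1), cap i, cup i] φ = act [cup i] φ :=
      (wordEq_zigzag_right hi).context [] [cup i] (isTangle_nil n) φ (normalSpace_le R n hφ)
    rw [← h1, act_cons]
    exact act_algebraWord_mem_normalSpace hR ih (.hook (by omega))

theorem act_cup_core_cap_mem_normalSpace {A B a : K} (hR : GraphicalCalculus A B a R) {k : ℕ}
    {φ : List Event → K} (hφ : φ ∈ normalSpace R (k + 1)) {y : List Event}
    (hy : y ∈ insert [] (letters k)) :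
    act (cup (k + 1) :: (y ++ [cap (k + 1)])) φ ∈ normalSpace R (k + 1) := by
  have hφ' := normalSpace_le R _ hφ
  rcases hy with rfl | rfl | rfl
  · change act [cup (k + 1), cap (k + 1)] φ ∈ _
    rw [act_circle_right hR le_rfl hφ']
    exact Submodule.smul_mem _ _ hφ
  · change act [cup (k + 1), vertex k, cap (k + 1)] φ ∈ _
    rw [act_loop hR le_rfl hφ']
    exact Submodule.smul_mem _ _ hφ
  · have h1 : WordEq R (k + 1) [cup (k + 1), cap k, cup k, cap (k + 1)] [cup k, cap (k + 1)] :=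
      (wordEq_zigzag_right le_rfl).context [] [cup k, cap (k + 1)] (isTangle_nil _)
    change act [cup (k + 1), cap k, cup k, cap (k + 1)] φ ∈ _
    rw [(h1.trans (wordEq_zigzag_left le_rfl)) φ hφ']
    exact hφ

/-- As for letters, the word between minimum and maximum is put in the form `r y s`, with `r` moved
below the minimum and `s` above the maximum. What remains is a circle, a loop or a zigzag beside a
strand. -/
theorem act_last_cap_mem_normalSpace {A B a : K} (hR : GraphicalCalculus A B a R) {n : ℕ}
    {φ : List Event → K} (hφ : φ ∈ normalSpace R (n + 2)) :
    act [cap n] φ ∈ normalSpace R n := by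
  refine map_mem_of_mem_span _ ?_ hφ
  rintro _ ⟨θ, hθ, w, hw, rfl⟩
  rcases n with _ | k
  · rw [hw.eq_nil, ← act_append]
    refine map_mem_of_mem_span _ ?_ hθ
    rintro _ (rfl | rfl)
    · rw [act_lowerFunctional]
      exact Submodule.subset_span (.inr rfl)
    -- Two circles: the second one provides the strand at which the first is removed, with factor
    -- `mu`.
    · have h0 : lowerFunctional R [] ∈ lowerSpace R 0 := Submodule.subset_span ⟨[], rfl, rfl⟩
      have h1 : lowerFunctional R [cup 0, cap 0] = act [cup 0, cap 0] (lowerFunctional R []) := by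
        rw [act_lowerFunctional]
        rfl
      rw [h1]
      change act [cap 0] (act [cup 0, cap 0, cup 0] (lowerFunctional R [])) ∈ _
      rw [act_cup_cap_cup hR le_rfl h0, map_smul, ← act_append, act_lowerFunctional]
      exact Submodule.smul_mem _ _ (Submodule.subset_span (.inr rfl))
  · have hθ' := normalSpace_le R _ hθ
    rw [act_cons (cup _)]
    refine map_mem_of_mem_span _ ?_ (act_mem_sandwich hR (n := k) (N := k + 3) (by omega)
      (act_mem_lowerSpace (isTangle_cup le_rfl) hθ') hw)
    rintro _ ⟨r, y, s, hr, hy, hs, rfl⟩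
    have hr' := act_algebraWord_mem_normalSpace hR hθ hr
    have hrT := hr.isTangle le_rfl
    have hyT : IsTangle (k + 3) y (k + 3) := by
      rcases hy with rfl | hy
      · rfl
      · exact isTangle_letter (by omega) hy
    have e1 : act (r ++ [cup (k + 1)]) θ = act ([cup (k + 1)] ++ r) θ :=
      wordEq_word_right hrT (isTangle_cup le_rfl) (by simp [cup]) le_rfl θ hθ'
    have e2 : act (s ++ [cap (k + 1)]) (act (r ++ [cup (k + 1)] ++ y) θ) = _ :=
      wordEq_word_right (hs.isTangle le_rfl) (isTangle_cap_cons.2 ⟨le_rfl, isTangle_nil _⟩)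
        (by simp [cap]) (by omega) _
        (act_mem_lowerSpace ((hrT.append (isTangle_cup le_rfl)).append hyT) hθ')
    simp only [act_append] at e1 e2 ⊢
    rw [← e1, e2]
    have key := act_cup_core_cap_mem_normalSpace hR hr' hy
    rw [act_cons, act_append] at key
    exact act_algebraWord_mem_normalSpace hR key hs

/-- A maximum is a hook followed by the maximum one place further right; the hook preserves the
normal form. -/
theorem act_cap_mem_normalSpace {A B a : K} (hR : GraphicalCalculus A B a R) {n i : ℕ}
    (h : i ≤ n) {φ : List Event → K} (hφ : φ ∈ normalSpace R (n + 2)) :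
    act [cap i] φ ∈ normalSpace R n := by
  induction h using Nat.decreasingInduction generalizing φ with
  | self => exact act_last_cap_mem_normalSpace hR hφ
  | of_succ i hi ih =>
    have h1 : act [cap i, cup i, cap (i + 1)] φ = act [cap i] φ :=
      (wordEq_zigzag_left hi).context [cap i] []
        ((isTangle_cap_cons (n := n + 2)).2 ⟨by omega, isTangle_nil n⟩) φ (normalSpace_le R _ hφ)
    rw [← h1]
    exact ih (act_algebraWord_mem_normalSpace hR hφ (.hook (by omega)))

theorem act_mem_normalSpace {A B a : K} (hR : GraphicalCalculus A B a R) {w : List Event}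
    {m n : ℕ} (hw : IsTangle m w n) {φ : List Event → K} (hφ : φ ∈ normalSpace R m) :
    act w φ ∈ normalSpace R n := by
  induction w generalizing m φ with
  | nil =>
    rw [isTangle_nil_iff] at hw
    exact hw ▸ hφ
  | cons e w ih =>
    rw [act_cons]
    obtain ⟨k, i⟩ := e
    cases k with
    | cup =>
      obtain ⟨hi, hw⟩ := isTangle_cup_cons.1 hw
      exact ih hw (act_cup_mem_normalSpace hR hi hφ)
    | cap =>
      obtain ⟨hi, hw⟩ := isTangle_cap_cons.1 hw
      obtain ⟨m, rfl⟩ := Nat.exists_eq_add_of_le' (show 2 ≤ m by omega)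
      exact ih hw (act_cap_mem_normalSpace hR (by omega) hφ)
    | vertex =>
      obtain ⟨hi, hw⟩ := isTangle_vertex_cons.1 hw
      exact ih hw (act_algebraWord_mem_normalSpace hR hφ (.vertex hi))

/-! ### Uniqueness -/

theorem GraphicalCalculus.sub {A B a : K} {P Q : PlanarGraph → K}
    (hP : GraphicalCalculus A B a P) (hQ : GraphicalCalculus A B a Q) :
    GraphicalCalculus A B a (P - Q) where
  circle S := by simp only [Pi.sub_apply, hP.circle, hQ.circle]; ring
  loop S := by simp only [Pi.sub_apply, hP.loop, hQ.loop]; ring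
  bigon S := by simp only [Pi.sub_apply, hP.bigon, hQ.bigon]; ring
  triangle S := by
    have h1 := hP.triangle S
    have h2 := hQ.triangle S
    simp only [Pi.sub_apply]
    linear_combination h1 - h2

/-- A function that satisfies the graphical calculus and vanishes on the unknot is zero. -/
theorem GraphicalCalculus.eq_zero {A B a : K} (hR : GraphicalCalculus A B a R)
    (h : R unknot = 0) : R = 0 := by
  funext G
  obtain ⟨D, rfl⟩ := Quot.exists_rep G
  have h0 : lowerFunctional R [] ∈ normalSpace R 0 := Submodule.subset_span (.inl rfl)
  have hD := act_mem_normalSpace hR D.closed h0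
  rw [act_lowerFunctional, List.nil_append] at hD
  obtain ⟨α, β, hαβ⟩ := Submodule.mem_span_pair.1 hD
  have hval := congrFun hαβ []
  -- The empty diagram is not a planar graph here, so its value is the default zero; the circle has
  -- value zero by hypothesis.
  have e1 : wordValue R [] = 0 := dif_neg fun h => h.2 rfl
  have e2 : wordValue R [cup 0, cap 0] = 0 := by
    rw [wordValue, dif_pos ⟨by decide, by decide⟩]
    exact h
  have e3 : wordValue R D.events = R (.mk D) := dif_pos ⟨D.closed, D.nonempty⟩
  simp only [Pi.add_apply, Pi.smul_apply, lowerFunctional, List.append_nil, e1, e2, e3,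
    smul_zero, add_zero] at hval
  exact hval.symm

end PlanarCalculus

/-- A function on planar 4-valent graphs that satisfies the graphical calculus and takes the value
`1` on the unknot is unique. -/
theorem theorem3 {K : Type*} [Field K] (A B a : K) (hAB : A ≠ B) (ha : a ≠ 0)
    (P Q : PlanarCalculus.PlanarGraph → K)
    (hP : PlanarCalculus.GraphicalCalculus A B a P) (hP_unknot : P PlanarCalculus.unknot = 1)
    (hQ : PlanarCalculus.GraphicalCalculus A B a Q) (hQ_unknot : Q PlanarCalculus.unknot = 1) :
    P = Q :=
  sub_eq_zero.1 ((hP.sub hQ).eq_zero (by simp [hP_unknot, hQ_unknot]))
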